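/- **Theorem (Riesz representation).** Let $I=[a,b]\subset\mathbb R$ with $a<b$, and let $\varphi\colon I\times[0,\infty)\to[0,\infty]$ be a convex $\Phi$-function, $\varphi\in\Phi_c(I)$, i.e. - $x\mapsto\varphi(x,|u(x)|)$ is measurable on $I$ for every measurable $u\colon I\to\mathbb R$; - for every $x\in I$, $t\mapsto\varphi(x,t)$ is non-decreasing, convex and left-continuous, $\varphi(x,0)=\lim_{t\to0^+}\varphi(x,t)=0$ and $\lim_{t\to\infty}\varphi(x,t)=\infty$; - there is $L\ge1$ with $\frac{\varphi(x,s)}s\le L\,\frac{\varphi(x,t)}t$ for all $x\in I$ and $0<s<t$. Assume moreover: - (VA1) for every $K>0$ there is a modulus of continuity $\omega$ (a non-decreasing function $\omega\colon[0,\infty)\to[0,\infty)$ with $\omega(0)=\lim_{r\to0^+}\omega(r)=0$) such that, for every ball $B\subset\mathbb R$ of radius $r>0$, all $x,y\in B\cap I$ and all $t\ge0$, $$\varphi\Big(x,\frac{t}{1+\omega(r)}\Big)\le\varphi(y,t)+\omega(r)\quad\text{whenever}\quad \varphi(y,t)\le\frac K{|B|};$$ - (Dec) there is $q\in(1,\infty)$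 such that $t\mapsto\varphi(x,t)/t^q$ is non-increasing on $(0,\infty)$ for every $x\in I$. Let $f\colon I\to\mathbb R$ be a function of bounded variation that is left-continuous at every point of $(a,b]$. Let $Df$ be its derivative measure, i.e. the finite signed Borel measure on $I$ with $Df([a,x))=f(x)-f(a)$ for all $x\in[a,b]$ and $Df(\{b\})=0$ (so a jump of $f$ at $a$ is counted), and let $Df=f'\,dx+D^sf$ be its Lebesgue decomposition into an absolutely continuous part with density $f'$ and a singular part $D^sf$, whose total variation measure is $|D^sf|$. Put $\varphi'_\infty(x):=\lim_{t\to\infty}\varphi(x,t)/t\in[0,\infty]$ and $$\overline V^{\varphi}_I(f):=\limsup_{\max_k|I_k|\to0}\ \sum_{k=1}^n\Big(\sup_{x\in I_k}\varphi\Big(x,\frac{|f(b_k)-f(a_k)|}{|I_k|}\Big)\Big)|I_k|,$$ where the upper limit is taken over finite partitions of $I$ into non-degenerate closed intervals $I_k=[a_k,b_k]$ with disjoint interiors. Then, as an equality in $[0,\infty]$, $$\overline V^{\varphi}_I(f)=\int_I\varphi(x,|f'(x)|)\,dx+\int_I\varphi'_\infty\,d|D^sf|.$$ -/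

import Mathlib

open Set Filter MeasureTheory Topology
open scoped NNReal ENNReal

noncomputable section

namespace RieszBV

/-! ### Generalized Phi-functions

A function `φ : Ω × [0, ∞) → [0, ∞]` is written as `φ : ℝ → ℝ≥0 → ℝ≥0∞`; only its values at
points `x ∈ Ω` are ever constrained or used. -/

/-- `φ` is a weak Phi-function on `Ω`. "Measurable" means Lebesgue measurable on `Ω`, that is,
a.e.-measurable with respect to Lebesgue measure restricted to `Ω`. -/
structure IsWeakPhi (Ω : Set ℝ) (φ : ℝ → ℝ≥0 → ℝ≥0∞) : Prop where
  measurable_comp : ∀ u : ℝ → ℝ≥0, AEMeasurable u (volume.restrict Ω) →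
    AEMeasurable (fun x => φ x (u x)) (volume.restrict Ω)
  monotone : ∀ x ∈ Ω, Monotone (φ x)
  zero : ∀ x ∈ Ω, φ x 0 = 0
  tendsto_zero : ∀ x ∈ Ω, Tendsto (φ x) (𝓝[>] 0) (𝓝 0)
  tendsto_top : ∀ x ∈ Ω, Tendsto (φ x) atTop (𝓝 ∞)
  almost_increasing : ∃ L : ℝ≥0, 1 ≤ L ∧ ∀ x ∈ Ω, ∀ s t : ℝ≥0, 0 < s → s < t →
    φ x s / s ≤ L * (φ x t / t)

/-- `φ` is a convex Phi-function on `Ω`: a weak Phi-function which is convex and left-continuous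
in its second variable. -/
structure IsConvexPhi (Ω : Set ℝ) (φ : ℝ → ℝ≥0 → ℝ≥0∞) : Prop extends IsWeakPhi Ω φ where
  convex : ∀ x ∈ Ω, ConvexOn ℝ≥0 univ (φ x)
  left_continuous : ∀ x ∈ Ω, ∀ t : ℝ≥0, ContinuousWithinAt (φ x) (Iic t) t

/-- A modulus of continuity. -/
structure IsModulus (ω : ℝ≥0 → ℝ≥0) : Prop where
  monotone : Monotone ω
  zero : ω 0 = 0
  tendsto_zero : Tendsto ω (𝓝 0) (𝓝 0)

/-- The condition (VA1) on `Ω`. -/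
def VA1 (Ω : Set ℝ) (φ : ℝ → ℝ≥0 → ℝ≥0∞) : Prop :=
  ∀ K : ℝ≥0, 0 < K → ∃ ω : ℝ≥0 → ℝ≥0, IsModulus ω ∧
    ∀ (c : ℝ) (r : ℝ≥0), 0 < r →
      ∀ x ∈ Metric.ball c r ∩ Ω, ∀ y ∈ Metric.ball c r ∩ Ω, ∀ t : ℝ≥0,
        φ y t ≤ K / volume (Metric.ball c (r : ℝ)) →
          φ x (t / (1 + ω r)) ≤ φ y t + ω r

/-- The condition (Dec)_q on `Ω`: `t ↦ φ x t / t ^ q` is non-increasing on `(0, ∞)`. -/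
def DecWith (Ω : Set ℝ) (φ : ℝ → ℝ≥0 → ℝ≥0∞) (q : ℝ) : Prop :=
  ∀ x ∈ Ω, ∀ s t : ℝ≥0, 0 < s → s < t →
    φ x t / (t : ℝ≥0∞) ^ q ≤ φ x s / (s : ℝ≥0∞) ^ q

/-- The condition (Dec) on `Ω`: (Dec)_q holds for some finite `q > 1`. -/
def Dec (Ω : Set ℝ) (φ : ℝ → ℝ≥0 → ℝ≥0∞) : Prop :=
  ∃ q : ℝ, 1 < q ∧ DecWith Ω φ q

/-- The function `φ'_∞(x) = lim_{t → ∞} φ(x, t) / t`. -/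
def recession (φ : ℝ → ℝ≥0 → ℝ≥0∞) (x : ℝ) : ℝ≥0∞ :=
  limUnder atTop fun t : ℝ≥0 => φ x t / t

/-! ### The limsup Riesz variation -/

/-- The function `φ⁺_A(t) = sup_{x ∈ A} φ(x, t)`. -/
def phiSup (φ : ℝ → ℝ≥0 → ℝ≥0∞) (A : Set ℝ) (t : ℝ≥0) : ℝ≥0∞ :=
  ⨆ x ∈ A, φ x t

/-- A partition of `[a, b]` into the `n` non-degenerate closed intervals `[pt k, pt (k + 1)]`,
`k < n`. The values `pt k` for `k > n` play no role. -/
structure Partition (a b : ℝ) where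
  n : ℕ
  pt : ℕ → ℝ
  pt_zero : pt 0 = a
  pt_last : pt n = b
  pt_lt : ∀ k < n, pt k < pt (k + 1)

namespace Partition

variable {a b : ℝ}

/-- The length of the `k`-th interval. -/
def len (P : Partition a b) (k : ℕ) : ℝ≥0 := (P.pt (k + 1) - P.pt k).toNNReal

/-- The largest length of an interval of the partition. -/
def mesh (P : Partition a b) : ℝ≥0 := (Finset.range P.n).sup P.len

/-- The sum `∑ φ⁺_{I_k}(|Δ_k f| / |I_k|) |I_k|` over the intervals `I_k` of the partition. -/
def rieszSum (P : Partition a b) (φ : ℝ → ℝ≥0 → ℝ≥0∞) (f : ℝ → ℝ) : ℝ≥0∞ :=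
  ∑ k ∈ Finset.range P.n,
    phiSup φ (Icc (P.pt k) (P.pt (k + 1))) (‖f (P.pt k) - f (P.pt (k + 1))‖₊ / P.len k) * P.len k

end Partition

/-- The limsup Riesz `φ`-variation of `f` on `[a, b]`: the upper limit of the Riesz sums as the
mesh of the partition tends to zero. -/
def limsupVariation (φ : ℝ → ℝ≥0 → ℝ≥0∞) (a b : ℝ) (f : ℝ → ℝ) : ℝ≥0∞ :=
  limsup (fun P : Partition a b => P.rieszSum φ f) (comap Partition.mesh (𝓝 0))

/-! ### The derivative measure of a function of bounded variation on `[a, b]` -/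

/-- The restriction of `f` to `[a, b]`, extended by the constants `f a` and `f b`. -/
def constExtend {a b : ℝ} (hab : a ≤ b) (f : ℝ → ℝ) : ℝ → ℝ :=
  fun x => f (projIcc a b hab x)

theorem boundedVariationOn_constExtend {a b : ℝ} (hab : a ≤ b) {f : ℝ → ℝ}
    (hf : BoundedVariationOn f (Icc a b)) : BoundedVariationOn (constExtend hab f) univ := by
  have h := eVariationOn.comp_le_of_monotoneOn f (s := Icc a b) (t := univ)
    (fun x : ℝ => (projIcc a b hab x : ℝ))
    (fun x _ y _ hxy => monotone_projIcc hab hxy) (fun x _ => (projIcc a b hab x).2)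
  exact ne_top_of_le_ne_top hf h

/-- The derivative measure `Df` of a function `f` of bounded variation on `[a, b]`: the signed
measure on `ℝ` associated to the constant extension of `f`. It is carried by `[a, b]`, and for
left-continuous `f` it satisfies `Df([a, x)) = f x - f a` for all `x ∈ [a, b]`, see
`derivMeasure_Ico`; in particular a jump of `f` at `a` is an atom of `Df`. -/
def derivMeasure {a b : ℝ} (hab : a ≤ b) {f : ℝ → ℝ} (hf : BoundedVariationOn f (Icc a b)) :
    SignedMeasure ℝ :=
  (boundedVariationOn_constExtend hab hf).vectorMeasure

theorem leftLim_constExtend {a b : ℝ} (hab : a ≤ b) {f : ℝ → ℝ}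
    (hfl : ∀ x ∈ Ioc a b, ContinuousWithinAt f (Iic x) x) {x : ℝ} (hx : x ∈ Icc a b) :
    (constExtend hab f).leftLim x = f x := by
  have hval : constExtend hab f x = f x := by simp [constExtend, projIcc_of_mem hab hx]
  rw [← hval]
  apply ContinuousWithinAt.leftLim_eq
  rcases hx.1.eq_or_lt with rfl | hax
  · refine (continuousWithinAt_const (b := f a)).congr (fun y hy => ?_) ?_
    · simp [constExtend, projIcc_of_le_left hab (mem_Iic.1 hy)]
    · simpa using hval
  · refine (hfl x ⟨hax, hx.2⟩).congr_of_eventuallyEq ?_ hval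
    filter_upwards [inter_mem_nhdsWithin (Iic x) (Ioi_mem_nhds hax)] with y hy
    simp [constExtend, projIcc_of_mem hab ⟨le_of_lt hy.2, le_trans hy.1 hx.2⟩]

theorem derivMeasure_Ico {a b : ℝ} (hab : a ≤ b) {f : ℝ → ℝ}
    (hf : BoundedVariationOn f (Icc a b))
    (hfl : ∀ x ∈ Ioc a b, ContinuousWithinAt f (Iic x) x) {x : ℝ} (hx : x ∈ Icc a b) :
    derivMeasure hab hf (Ico a x) = f x - f a := by
  rw [derivMeasure, BoundedVariationOn.vectorMeasure_Ico _ hx.1, leftLim_constExtend hab hfl hx,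
    leftLim_constExtend hab hfl ⟨le_rfl, hab⟩]

/-- The density `f'` of the absolutely continuous part of `Df` with respect to Lebesgue measure. -/
def derivDensity {a b : ℝ} (hab : a ≤ b) {f : ℝ → ℝ} (hf : BoundedVariationOn f (Icc a b)) :
    ℝ → ℝ :=
  (derivMeasure hab hf).rnDeriv volume

/-- The total variation `|D^s f|` of the singular part of `Df` with respect to Lebesgue
measure. -/
def singularVariation {a b : ℝ} (hab : a ≤ b) {f : ℝ → ℝ}
    (hf : BoundedVariationOn f (Icc a b)) : Measure ℝ :=
  ((derivMeasure hab hf).singularPart volume).totalVariation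

end RieszBV

end

/-! Upper bound: Jensen's inequality with an error. If φ did not depend on x, a supporting line of φ
at t = |Δf|/|I|, integrated over an interval I against |f'| dx + |D^s f|, would bound φ(t)|I| by the
energy of I, because the slope of a line below φ is at most φ'_∞. In general the line supporting
φ(y, ·) need not lie below φ(x, ·) for another x ∈ I. By (VA1) and (Dec) it does lie below (1 +
ε)(φ(x, ·) + ε) as long as φ(y, t) ≤ K/|I| (`VA1.exists_support_le`), and Jensen's argument survives
(`affine_integral_le`). The proviso removes itself: with K slightly larger than the bound being
proved, continuity of φ(y, ·) forbids the level K/|I| from being reached (`exists_realPhi_mul_le`).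
Summing over the partition and letting ε → 0 gives `limsupVariation_le`.

Lower bound: let ν = dx + |D^s f| on [a, b). The Riesz sum of a dyadic partition is the ν-integral
of φ⁺_I(d/c) c, where c = |I|/ν(I) and d = |Δf|/ν(I) on the cell I. By martingale convergence
(`ae_tendsto_average_cell`), c → 1 and d → |f'| at ν-almost every point off a Lebesgue null set
carrying D^s f, while c → 0 and d → 1 on that set. Since φ⁺_I ≥ φ(x, ·) for x ∈ I, the lower limits
of the integrands are at least φ(x, |f'|) and φ'_∞(x) respectively, and Fatou's lemma concludes
(`relaxedEnergy_le_limsupVariation`). -/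

namespace RieszBV

/-! ### Convex Phi-functions satisfying (Dec), pointwise in `x` -/

/-- The real-valued version of `φ x`, on `[0, ∞)`. -/
noncomputable def realPhi (φ : ℝ → ℝ≥0 → ℝ≥0∞) (x t : ℝ) : ℝ := (φ x t.toNNReal).toReal

section Pointwise

variable {Ω : Set ℝ} {φ : ℝ → ℝ≥0 → ℝ≥0∞} {q x y : ℝ}

/-- Values near t = 0 are finite because φ(x, t) → 0, and (Dec) propagates finiteness to larger t.
This is what makes the passage to real-valued functions lossless. -/
theorem DecWith.ne_top (hφ : IsWeakPhi Ω φ) (hd : DecWith Ω φ q) (hx : x ∈ Ω) (t : ℝ≥0) :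
    φ x t ≠ ∞ := by
  intro ht
  have h0 : ∀ᶠ s in 𝓝[>] (0 : ℝ≥0), φ x s < 1 :=
    (hφ.tendsto_zero x hx).eventually (gt_mem_nhds one_pos)
  have ht0 : 0 < t := by
    rcases eq_or_ne t 0 with rfl | h
    · simp [hφ.zero x hx] at ht
    · exact pos_iff_ne_zero.2 h
  obtain ⟨s, hs, hs0, hst⟩ := (h0.and (Ioo_mem_nhdsGT ht0)).exists
  have h := hd x hx s t hs0 hst
  rw [ht, ENNReal.top_div_of_ne_top
    (ENNReal.rpow_ne_top_of_ne_zero (by simpa using ht0.ne') ENNReal.coe_ne_top), top_le_iff,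
    ENNReal.div_eq_top] at h
  rcases h with ⟨-, h⟩ | ⟨h, -⟩
  · rw [ENNReal.rpow_eq_zero_iff] at h
    simp [hs0.ne'] at h
  · simp [h] at hs

theorem DecWith.coe_realPhi (hφ : IsWeakPhi Ω φ) (hd : DecWith Ω φ q) (hx : x ∈ Ω) (t : ℝ) :
    ENNReal.ofReal (realPhi φ x t) = φ x t.toNNReal :=
  ENNReal.ofReal_toReal (hd.ne_top hφ hx _)

theorem realPhi_nonneg (t : ℝ) : 0 ≤ realPhi φ x t := ENNReal.toReal_nonneg

theorem IsWeakPhi.realPhi_zero (hφ : IsWeakPhi Ω φ) (hx : x ∈ Ω) : realPhi φ x 0 = 0 := by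
  simp [realPhi, hφ.zero x hx]

theorem DecWith.realPhi_mono (hφ : IsWeakPhi Ω φ) (hd : DecWith Ω φ q) (hx : x ∈ Ω) :
    Monotone (realPhi φ x) := fun _ _ h =>
  ENNReal.toReal_mono (hd.ne_top hφ hx _) (hφ.monotone x hx (Real.toNNReal_mono h))

theorem DecWith.realPhi_convexOn (hφ : IsConvexPhi Ω φ) (hd : DecWith Ω φ q) (hx : x ∈ Ω) :
    ConvexOn ℝ (Ici 0) (realPhi φ x) := by
  refine ⟨convex_Ici 0, fun s hs t ht α β hα hβ hαβ => ?_⟩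
  rw [mem_Ici] at hs ht
  have h := (hφ.convex x hx).2 (mem_univ s.toNNReal) (mem_univ t.toNNReal)
    (show 0 ≤ α.toNNReal from zero_le) (show 0 ≤ β.toNNReal from zero_le)
    (by rw [← Real.toNNReal_add hα hβ, hαβ, Real.toNNReal_one])
  simp only [smul_eq_mul, realPhi]
  rw [Real.toNNReal_add (by positivity) (by positivity), Real.toNNReal_mul hα,
    Real.toNNReal_mul hβ]
  simp only [smul_eq_mul, ENNReal.smul_def] at h
  have h1 := hd.ne_top hφ.toIsWeakPhi hx s.toNNReal
  have h2 := hd.ne_top hφ.toIsWeakPhi hx t.toNNReal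
  have h3 := ENNReal.toReal_mono (by finiteness) h
  rw [ENNReal.toReal_add (by finiteness) (by finiteness), ENNReal.toReal_mul,
    ENNReal.toReal_mul] at h3
  simpa [hα, hβ] using h3

/-- (Dec) in multiplicative form: it turns a dilation of the argument, such as the one in (VA1),
into a factor on the value. -/
theorem DecWith.realPhi_mul_le (hφ : IsWeakPhi Ω φ) (hd : DecWith Ω φ q) (hx : x ∈ Ω)
    {l t : ℝ} (hl : 1 ≤ l) (ht : 0 ≤ t) :
    realPhi φ x (l * t) ≤ l ^ q * realPhi φ x t := by
  rcases ht.eq_or_lt with rfl | ht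
  · simp [hφ.realPhi_zero hx]
  rcases hl.eq_or_lt with rfl | hl
  · simp
  have h := hd x hx t.toNNReal (l * t).toNNReal (by simpa using ht)
    ((Real.toNNReal_lt_toNNReal_iff (by positivity)).2 (by nlinarith))
  have ht' : (t.toNNReal : ℝ≥0∞) ≠ 0 := by simpa using ht
  have h1 := hd.ne_top hφ hx t.toNNReal
  have h3 := ENNReal.toReal_mono
    (ENNReal.div_ne_top h1 (by simp [ENNReal.rpow_eq_zero_iff, ht])) h
  rw [ENNReal.toReal_div, ENNReal.toReal_div, ← ENNReal.toReal_rpow, ← ENNReal.toReal_rpow] at h3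
  simp only [ENNReal.coe_toReal, Real.coe_toNNReal _ ht.le,
    Real.coe_toNNReal _ (show 0 ≤ l * t by positivity)] at h3
  rw [Real.mul_rpow (by positivity) ht.le, div_le_div_iff₀ (by positivity) (by positivity)] at h3
  have := Real.rpow_pos_of_pos ht q
  unfold realPhi
  nlinarith

theorem DecWith.realPhi_continuousOn (hφ : IsConvexPhi Ω φ) (hd : DecWith Ω φ q) (hx : x ∈ Ω) :
    ContinuousOn (realPhi φ x) (Ici 0) := by
  refine (hd.realPhi_convexOn hφ hx).continuousOn_Ici ?_
  rw [← continuousWithinAt_Ioi_iff_Ici]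
  have h := (ENNReal.tendsto_toReal ENNReal.zero_ne_top).comp (hφ.tendsto_zero x hx)
  have h2 : Tendsto Real.toNNReal (𝓝[>] 0) (𝓝[>] 0) := by
    refine tendsto_nhdsWithin_iff.2 ⟨?_, ?_⟩
    · simpa using (continuous_real_toNNReal.tendsto 0).mono_left nhdsWithin_le_nhds
    · filter_upwards [self_mem_nhdsWithin] with t ht
      simpa using ht
  rw [ContinuousWithinAt, hφ.realPhi_zero hx]
  exact h.comp h2

theorem DecWith.realPhi_div_mono (hφ : IsConvexPhi Ω φ) (hd : DecWith Ω φ q) (hx : x ∈ Ω)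
    {s t : ℝ} (hs : 0 < s) (hst : s ≤ t) : t / s * realPhi φ x s ≤ realPhi φ x t := by
  have ht : 0 < t := hs.trans_le hst
  have h := (hd.realPhi_convexOn hφ hx).2 (mem_Ici.2 le_rfl) (mem_Ici.2 ht.le)
    (show 0 ≤ 1 - s / t by rw [sub_nonneg, div_le_one ht]; exact hst)
    (show 0 ≤ s / t by positivity) (by ring)
  simp only [smul_eq_mul, mul_zero, zero_add, hφ.realPhi_zero hx] at h
  rw [div_mul_cancel₀ _ ht.ne'] at h
  calc t / s * realPhi φ x s ≤ t / s * (s / t * realPhi φ x t) := by gcongr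
    _ = realPhi φ x t := by field_simp

theorem DecWith.realPhi_exists_eq (hφ : IsConvexPhi Ω φ) (hd : DecWith Ω φ q) (hx : x ∈ Ω)
    {s M : ℝ} (hs : 0 ≤ s) (hM : realPhi φ x s ≤ M) : ∃ T, s ≤ T ∧ realPhi φ x T = M := by
  obtain ⟨u, hu⟩ := ((hφ.tendsto_top x hx).eventually
    (lt_mem_nhds (ENNReal.ofReal_lt_top (r := M)))).exists
  have hM0 : 0 ≤ M := (realPhi_nonneg s).trans hM
  have hMu : M ≤ realPhi φ x u := by
    have := ENNReal.toReal_mono (hd.ne_top hφ.toIsWeakPhi hx _) hu.le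
    rw [ENNReal.toReal_ofReal hM0] at this
    simpa [realPhi] using this
  have hMu' := hMu.trans (hd.realPhi_mono hφ.toIsWeakPhi hx (le_max_right s u))
  obtain ⟨T, hT, hTM⟩ := intermediate_value_Icc (le_max_left s (u : ℝ))
    ((hd.realPhi_continuousOn hφ hx).mono fun z hz => hs.trans hz.1) ⟨hM, hMu'⟩
  exact ⟨T, hT.1, hTM⟩

theorem DecWith.realPhi_exists_support (hφ : IsConvexPhi Ω φ) (hd : DecWith Ω φ q) (hx : x ∈ Ω)
    {t : ℝ} (ht : 0 < t) :
    ∃ p : ℝ, 0 ≤ p ∧ ∀ s, 0 ≤ s → realPhi φ x t + p * (s - t) ≤ realPhi φ x s := by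
  have hc := hd.realPhi_convexOn hφ hx
  have hti : t ∈ interior (Ici (0 : ℝ)) := by simpa using ht
  have key : ∀ s, 0 ≤ s → realPhi φ x t + derivWithin (realPhi φ x) (Ioi t) t * (s - t) ≤
      realPhi φ x s := by
    intro s hs
    rcases lt_trichotomy s t with h | rfl | h
    · have h1 := (hc.slope_le_leftDeriv_of_mem_interior hs hti h).trans
        (hc.leftDeriv_le_rightDeriv_of_mem_interior hti)
      rw [slope_def_field, div_le_iff₀ (by linarith)] at h1
      linarith
    · simp
    · have h1 := hc.rightDeriv_le_slope_of_mem_interior hti hs h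
      rw [slope_def_field, le_div_iff₀ (by linarith)] at h1
      linarith
  -- The line at s = 0 lies below φ(x, 0) = 0 while its value at t is nonnegative, so its slope is
  -- nonnegative.
  refine ⟨_, ?_, key⟩
  have h0 := key 0 le_rfl
  rw [hφ.realPhi_zero hx] at h0
  have := realPhi_nonneg (φ := φ) (x := x) t
  by_contra! hneg
  nlinarith

theorem IsConvexPhi.monotone_div (hφ : IsConvexPhi Ω φ) (hd : DecWith Ω φ q) (hx : x ∈ Ω) :
    Monotone fun t : ℝ≥0 => φ x t / t := by
  intro s t hst
  rcases eq_or_ne s 0 with rfl | hs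
  · simp [hφ.zero x hx]
  have hs' : 0 < s := pos_iff_ne_zero.2 hs
  have ht' : 0 < t := hs'.trans_le hst
  have h := hd.realPhi_div_mono hφ hx (s := s) (t := t) (by exact_mod_cast hs')
    (by exact_mod_cast hst)
  have h1 := hd.ne_top hφ.toIsWeakPhi hx s
  have h2 := hd.ne_top hφ.toIsWeakPhi hx t
  rw [← ENNReal.toReal_le_toReal (ENNReal.div_ne_top h1 (by simpa using hs))
    (ENNReal.div_ne_top h2 (by simpa using ht'.ne')), ENNReal.toReal_div, ENNReal.toReal_div]
  simp only [realPhi, Real.toNNReal_coe, ENNReal.coe_toReal] at h ⊢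
  have hs2 : (0 : ℝ) < s := by exact_mod_cast hs'
  have ht2 : (0 : ℝ) < t := by exact_mod_cast ht'
  rw [div_le_div_iff₀ hs2 ht2]
  rw [div_mul_eq_mul_div, div_le_iff₀ hs2] at h
  linarith

/-- Monotonicity of the quotient ensures that the `limUnder` in `recession` is a genuine limit. -/
theorem IsConvexPhi.tendsto_recession (hφ : IsConvexPhi Ω φ) (hd : DecWith Ω φ q) (hx : x ∈ Ω) :
    Tendsto (fun t : ℝ≥0 => φ x t / t) atTop (𝓝 (recession φ x)) := by
  have h := tendsto_atTop_iSup (hφ.monotone_div hd hx)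
  rwa [recession, h.limUnder_eq]

theorem IsConvexPhi.div_le_recession (hφ : IsConvexPhi Ω φ) (hd : DecWith Ω φ q) (hx : x ∈ Ω)
    (t : ℝ≥0) : φ x t / t ≤ recession φ x :=
  (hφ.monotone_div hd hx).ge_of_tendsto (hφ.tendsto_recession hd hx) t

/-- Phi-functions satisfying (Dec) are continuous. -/
theorem IsConvexPhi.continuous (hφ : IsConvexPhi Ω φ) (hd : DecWith Ω φ q) (hx : x ∈ Ω) :
    Continuous (φ x) := by
  have h : φ x = fun t : ℝ≥0 => ENNReal.ofReal (realPhi φ x t) := by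
    ext t; rw [hd.coe_realPhi hφ.toIsWeakPhi hx, Real.toNNReal_coe]
  rw [h]
  exact ENNReal.continuous_ofReal.comp
    ((hd.realPhi_continuousOn hφ hx).comp_continuous NNReal.continuous_coe fun t => t.2)

/-- An affine function lying below `φ x` up to constants has slope bounded by the recession
function. -/
theorem IsConvexPhi.le_recession_of_affine_le (hφ : IsConvexPhi Ω φ) (hd : DecWith Ω φ q)
    (hx : x ∈ Ω) {α β c d : ℝ} (hc : 0 < c)
    (h : ∀ s, 0 ≤ s → α + β * s ≤ c * (realPhi φ x s + d)) :
    ENNReal.ofReal β ≤ ENNReal.ofReal c * recession φ x := by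
  rcases eq_or_ne (recession φ x) ∞ with htop | htop
  · rw [htop, ENNReal.mul_top (by simpa using hc)]; exact le_top
  have hbd : ∀ s : ℝ, 0 ≤ s → realPhi φ x s ≤ (recession φ x).toReal * s := by
    intro s hs
    rcases hs.eq_or_lt with rfl | hs
    · simp [hφ.realPhi_zero hx]
    have := ENNReal.toReal_mono htop (hφ.div_le_recession hd hx s.toNNReal)
    rw [ENNReal.toReal_div, ENNReal.coe_toReal, Real.coe_toNNReal _ hs.le,
      div_le_iff₀ hs] at this
    exact this
  set R := (recession φ x).toReal with hR
  rw [← ENNReal.ofReal_toReal htop, ← ENNReal.ofReal_mul hc.le, ← hR]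
  refine ENNReal.ofReal_le_ofReal ?_
  by_contra! hlt
  have h1 : ∀ s : ℝ, 0 ≤ s → (β - c * R) * s ≤ c * d - α := by
    intro s hs
    have := h s hs
    have := mul_le_mul_of_nonneg_left (hbd s hs) hc.le
    linarith
  have hpos : 0 < β - c * R := by linarith
  have h2 := h1 ((|c * d - α| + 1) / (β - c * R)) (by positivity)
  rw [mul_div_cancel₀ _ hpos.ne'] at h2
  linarith [le_abs_self (c * d - α)]

end Pointwise

/-! ### Comparing nearby points -/

section Compare

variable {Ω : Set ℝ} {φ : ℝ → ℝ≥0 → ℝ≥0∞} {q : ℝ}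

/-- Apply (VA1) in the ball of radius h about the midpoint of x and y, then use (Dec) to remove the
dilation by 1 + ω(h) at the cost of a factor (1 + ω(h))^q, which tends to 1. -/
theorem VA1.exists_compare (hφ : IsWeakPhi Ω φ) (hd : DecWith Ω φ q)
    (hV : VA1 Ω φ) {K δ : ℝ} (hK : 0 < K) (hδ : 0 < δ) :
    ∃ h₀ > 0, ∀ h, 0 < h → h < h₀ → ∀ x ∈ Ω, ∀ y ∈ Ω, |x - y| ≤ h → ∀ t, 0 ≤ t →
      realPhi φ y t ≤ K / h → realPhi φ x t ≤ (1 + δ) * (realPhi φ y t + δ) := by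
  -- The ball has measure 2h, so K/h is 2K divided by its measure.
  obtain ⟨ω, hω, hball⟩ := hV (2 * K).toNNReal (by simpa using hK)
  have hlim : Tendsto (fun h : ℝ => (ω h.toNNReal : ℝ)) (𝓝[>] 0) (𝓝 0) := by
    have h1 : Tendsto Real.toNNReal (𝓝[>] 0) (𝓝 0) := by
      simpa using (continuous_real_toNNReal.tendsto 0).mono_left nhdsWithin_le_nhds
    exact (NNReal.continuous_coe.tendsto 0).comp (hω.tendsto_zero.comp h1)
  have hlim' : Tendsto (fun h : ℝ => (1 + (ω h.toNNReal : ℝ)) ^ q) (𝓝[>] 0) (𝓝 1) := by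
    simpa using (hlim.const_add 1).rpow_const (p := q) (Or.inl (by norm_num))
  have hev := (hlim.eventually (gt_mem_nhds hδ)).and
    (hlim'.eventually (gt_mem_nhds (show (1 : ℝ) < 1 + δ by linarith)))
  obtain ⟨h₀, hh₀, hsub⟩ := mem_nhdsGT_iff_exists_Ioo_subset.1 hev
  refine ⟨h₀, hh₀, fun h hpos hlt x hx y hy hxy t ht hle => ?_⟩
  obtain ⟨hω1, hω2⟩ := hsub ⟨hpos, hlt⟩
  set w : ℝ≥0 := ω h.toNNReal with hw
  have hw1 : (1 : ℝ) ≤ 1 + w := by linarith [w.2]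
  have habs := abs_le.1 hxy
  have hb := hball ((x + y) / 2) h.toNNReal (by simpa using hpos) x
    ⟨by rw [Metric.mem_ball, Real.dist_eq, Real.coe_toNNReal _ hpos.le, abs_lt]
        constructor <;> linarith, hx⟩ y
    ⟨by rw [Metric.mem_ball, Real.dist_eq, Real.coe_toNNReal _ hpos.le, abs_lt]
        constructor <;> linarith, hy⟩ t.toNNReal ?_
  · have h2 := ENNReal.toReal_mono (by have := hd.ne_top hφ hy t.toNNReal; finiteness) hb
    rw [ENNReal.toReal_add (hd.ne_top hφ hy _) (by simp), ENNReal.coe_toReal, ← hw] at h2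
    have h3 : realPhi φ x (t / (1 + w)) ≤ realPhi φ y t + w := by
      convert h2 using 2
      · rw [realPhi, Real.toNNReal_div ht, show (1 + w : ℝ) = ((1 + w : ℝ≥0) : ℝ) by simp,
          Real.toNNReal_coe]
      · rfl
    have h4 := hd.realPhi_mul_le hφ hx hw1 (t := t / (1 + w)) (by positivity)
    rw [mul_div_cancel₀ _ (by positivity)] at h4
    have := realPhi_nonneg (φ := φ) (x := y) t
    calc realPhi φ x t ≤ (1 + w) ^ q * (realPhi φ y t + w) := h4.trans (by gcongr)
      _ ≤ (1 + δ) * (realPhi φ y t + δ) := by gcongr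
  · rw [← hd.coe_realPhi hφ hy, Real.coe_toNNReal _ hpos.le, Real.volume_ball,
      ← ENNReal.ofReal, ← ENNReal.ofReal_div_of_pos (by positivity),
      mul_div_mul_left _ _ (by norm_num)]
    exact ENNReal.ofReal_le_ofReal hle

/-- An affine function grows at most as fast as linearly beyond a large multiple of its base
point. -/
theorem affine_le_of_dilate {A p t δ T s : ℝ} (hA : 0 ≤ A) (hp : 0 ≤ p) (ht : 0 < t) (hδ : 0 < δ)
    (hT : (1 + 1 / δ) * t ≤ T) (hTpos : 0 < T) (hs : T ≤ s) :
    A + p * (s - t) ≤ (1 + δ) * (s / T * (A + p * (T - t))) := by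
  have e1 : s / T * (A + p * (T - t)) = s / T * A + p * s - p * s * (t / T) := by
    field_simp
    ring
  have e2 : 1 ≤ s / T := by rwa [le_div_iff₀ hTpos, one_mul]
  have e3 : (1 + δ) * (t / T) ≤ δ := by
    rw [← mul_div_assoc, div_le_iff₀ hTpos]
    calc (1 + δ) * t = δ * ((1 + 1 / δ) * t) := by field_simp; ring
      _ ≤ δ * T := by gcongr
  have e4 : A ≤ s / T * A := le_mul_of_one_le_left hA e2
  have hps : 0 ≤ p * s := mul_nonneg hp (hTpos.le.trans hs)
  have e5 := mul_le_mul_of_nonneg_left e3 hps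
  have e6 : 0 ≤ δ * (s / T * A) := by positivity
  have e7 : 0 ≤ p * t := by positivity
  rw [e1]
  linarith

/-- Supporting lines of `φ y` at points with `φ y t ≤ K / h` almost support `φ x` from below for
all `x` at distance at most `h` from `y`. -/
theorem VA1.exists_support_le (hφ : IsConvexPhi Ω φ) (hd : DecWith Ω φ q)
    (hV : VA1 Ω φ) {K ε : ℝ} (hK : 0 < K) (hε : 0 < ε) :
    ∃ h₀ > 0, ∀ h, 0 < h → h < h₀ → ∀ x ∈ Ω, ∀ y ∈ Ω, |x - y| ≤ h → ∀ t p, 0 < t →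
      realPhi φ y t ≤ K / h → 0 ≤ p →
      (∀ s, 0 ≤ s → realPhi φ y t + p * (s - t) ≤ realPhi φ y s) →
      ∀ s, 0 ≤ s → realPhi φ y t + p * (s - t) ≤ (1 + ε) * (realPhi φ x s + ε) := by
  -- (VA1) compares φ(x, ·) with φ(y, ·) only on a bounded range, whereas the line must be
  -- controlled for all s. Up to a suitable T ≥ Ct the comparison is direct; beyond T the line grows
  -- at most like (1 + δ)s/T, and φ(x, ·) at least like s/T by convexity. The final factor (1 +
  -- δ)²(1 + 4δ) is at most 1 + ε since δ ≤ 1/4 and 20δ ≤ ε.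
  set δ := min (1 / 4) (ε / 20) with hδdef
  have hδ : 0 < δ := by positivity
  have hδ4 : δ ≤ 1 / 4 := min_le_left _ _
  have hδε : 20 * δ ≤ ε := by linarith [min_le_right (1 / 4 : ℝ) (ε / 20)]
  set C := 1 + 1 / δ with hC
  have hC1 : 1 ≤ C := by rw [hC]; linarith [show 0 < 1 / δ by positivity]
  set K' := C ^ q * K + 1 with hK'
  have hCq : 0 < C ^ q := Real.rpow_pos_of_pos (by linarith) q
  have hK'1 : 1 ≤ K' := by rw [hK']; linarith [mul_pos hCq hK]
  -- The comparison is used in both directions. From φ(y, T) ≤ K'/h the forward one only gives φ(x,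
  -- T) ≤ 4K'/h, the level at which the backward one starts.
  obtain ⟨h₀, hh₀, hcomp⟩ := hV.exists_compare hφ.toIsWeakPhi hd (K := 4 * K') (by positivity) hδ
  refine ⟨min h₀ 1, by positivity, fun h hpos hlt x hx y hy hxy t p ht hle hp hsup s hs => ?_⟩
  have hlt₀ : h < h₀ := hlt.trans_le (min_le_left _ _)
  have hlt1 : h < 1 := hlt.trans_le (min_le_right _ _)
  have hK'h : K' ≤ K' / h := by rw [le_div_iff₀ hpos]; nlinarith
  -- T is Ct if φ(y, Ct) ≥ 1, and otherwise a larger point with φ(y, T) = 1. Having φ(y, T) ≥ 1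
  -- keeps φ(x, T) away from 0, so the additive error δ can be absorbed as a factor 1 + 4δ.
  obtain ⟨T, hTC, hT1, hTK⟩ : ∃ T, C * t ≤ T ∧ 1 ≤ realPhi φ y T ∧ realPhi φ y T ≤ K' / h := by
    rcases le_total 1 (realPhi φ y (C * t)) with h1 | h1
    · refine ⟨C * t, le_rfl, h1, (hd.realPhi_mul_le hφ.toIsWeakPhi hy hC1 ht.le).trans ?_⟩
      calc C ^ q * realPhi φ y t ≤ C ^ q * (K / h) := by gcongr
        _ = (C ^ q * K) / h := by ring
        _ ≤ K' / h := by gcongr; linarith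
    · obtain ⟨T, hT, hT1⟩ := hd.realPhi_exists_eq hφ hy (by positivity) h1
      exact ⟨T, hT, hT1.ge, by rw [hT1]; linarith⟩
  have hTpos : 0 < T := by nlinarith
  have hxT : realPhi φ x T ≤ 4 * K' / h := by
    have h1 := hcomp h hpos hlt₀ x hx y hy hxy T hTpos.le (hTK.trans (by gcongr; linarith))
    calc realPhi φ x T ≤ (1 + δ) * (realPhi φ y T + δ) := h1
      _ ≤ (1 + 1 / 4) * (K' / h + 1 / 4) := by gcongr
      _ ≤ 4 * (K' / h) := by linarith
      _ = 4 * K' / h := by ring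
  have hyx : |y - x| ≤ h := by rwa [abs_sub_comm]
  have hback : ∀ u, 0 ≤ u → u ≤ T → realPhi φ y u ≤ (1 + δ) * (realPhi φ x u + δ) :=
    fun u hu huT => hcomp h hpos hlt₀ y hy x hx hyx u hu
      ((hd.realPhi_mono hφ.toIsWeakPhi hx huT).trans hxT)
  rcases le_total s T with hsT | hTs
  · have := realPhi_nonneg (φ := φ) (x := x) s
    calc _ ≤ realPhi φ y s := hsup s hs
      _ ≤ (1 + δ) * (realPhi φ x s + δ) := hback s hs hsT
      _ ≤ _ := by gcongr <;> linarith
  · set A := realPhi φ y t with hA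
    have hA0 : 0 ≤ A := realPhi_nonneg _
    have hs0 : 0 < s := hTpos.trans_le hTs
    have h1 := (hsup T hTpos.le).trans (hback T hTpos.le le_rfl)
    have h2 := hT1.trans (hback T hTpos.le le_rfl)
    have h3 : 1 / 4 ≤ realPhi φ x T := by nlinarith
    have h4 := hd.realPhi_div_mono hφ hx hTpos hTs
    have h5 : (1 + δ) * (realPhi φ x T + δ) ≤ (1 + δ) * (1 + 4 * δ) * realPhi φ x T := by
      rw [mul_assoc]
      gcongr
      nlinarith
    have h8 := realPhi_nonneg (φ := φ) (x := x) s
    have h9 : (1 + δ) * ((1 + δ) * (1 + 4 * δ)) ≤ 1 + ε := by nlinarith [mul_pos hδ hδ]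
    calc A + p * (s - t) ≤ (1 + δ) * (s / T * (A + p * (T - t))) :=
          affine_le_of_dilate hA0 hp ht hδ hTC hTpos hTs
      _ ≤ (1 + δ) * (s / T * ((1 + δ) * (1 + 4 * δ) * realPhi φ x T)) := by
          gcongr; exact h1.trans h5
      _ = (1 + δ) * ((1 + δ) * (1 + 4 * δ)) * (s / T * realPhi φ x T) := by ring
      _ ≤ (1 + δ) * ((1 + δ) * (1 + 4 * δ)) * realPhi φ x s := by gcongr
      _ ≤ (1 + ε) * (realPhi φ x s + ε) := by gcongr; linarith

end Compare

/-! ### The derivative measure -/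

section DerivMeasure

variable {a b : ℝ} {hab : a ≤ b} {f : ℝ → ℝ} {hf : BoundedVariationOn f (Icc a b)}

theorem derivMeasure_Ico_of_le (hfl : ∀ x ∈ Ioc a b, ContinuousWithinAt f (Iic x) x) {c d : ℝ}
    (hc : a ≤ c) (hcd : c ≤ d) (hd : d ≤ b) : derivMeasure hab hf (Ico c d) = f d - f c := by
  rw [derivMeasure, BoundedVariationOn.vectorMeasure_Ico _ hcd,
    leftLim_constExtend hab hfl ⟨hc.trans hcd, hd⟩, leftLim_constExtend hab hfl ⟨hc, hcd.trans hd⟩]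

theorem derivMeasure_apply {E : Set ℝ} (hE : MeasurableSet E) :
    derivMeasure hab hf E = (derivMeasure hab hf).singularPart volume E +
      ∫ x in E, derivDensity hab hf x := by
  conv_lhs => rw [← SignedMeasure.singularPart_add_withDensity_rnDeriv_eq
    (s := derivMeasure hab hf) (μ := volume)]
  rw [add_apply, withDensityᵥ_apply (SignedMeasure.integrable_rnDeriv _ _) hE]
  rfl

theorem abs_singularPart_apply_le {E : Set ℝ} (hE : MeasurableSet E) :
    |(derivMeasure hab hf).singularPart volume E| ≤ (singularVariation hab hf).real E := by
  rw [SignedMeasure.apply_eq_posPart_real_sub_negPart_real _ hE, singularVariation,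
    SignedMeasure.totalVariation, measureReal_add_apply]
  exact (abs_sub _ _).trans (by simp [abs_of_nonneg])

theorem measurable_derivDensity : Measurable (derivDensity hab hf) :=
  SignedMeasure.measurable_rnDeriv _ _

theorem integrable_derivDensity : Integrable (derivDensity hab hf) :=
  SignedMeasure.integrable_rnDeriv _ _

instance : IsFiniteMeasure (singularVariation hab hf) := by
  unfold singularVariation; infer_instance

theorem abs_sub_le_integral_add (hfl : ∀ x ∈ Ioc a b, ContinuousWithinAt f (Iic x) x) {c d : ℝ}
    (hc : a ≤ c) (hcd : c ≤ d) (hd : d ≤ b) :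
    |f d - f c| ≤ (∫ x in Ico c d, |derivDensity hab hf x|) +
      (singularVariation hab hf).real (Ico c d) := by
  rw [← derivMeasure_Ico_of_le (hab := hab) (hf := hf) hfl hc hcd hd,
    derivMeasure_apply measurableSet_Ico, add_comm]
  exact (abs_add_le _ _).trans
    (add_le_add abs_integral_le_integral_abs (abs_singularPart_apply_le measurableSet_Ico))

end DerivMeasure

/-! ### The upper bound -/

section Upper

variable {a b : ℝ} {hab : a ≤ b} {f : ℝ → ℝ} {hf : BoundedVariationOn f (Icc a b)}
  {φ : ℝ → ℝ≥0 → ℝ≥0∞} {q : ℝ}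

/-- The right-hand side of the Riesz representation, localised to `E`. -/
noncomputable def relaxedEnergy (φ : ℝ → ℝ≥0 → ℝ≥0∞) {a b : ℝ} (hab : a ≤ b) {f : ℝ → ℝ}
    (hf : BoundedVariationOn f (Icc a b)) (E : Set ℝ) : ℝ≥0∞ :=
  (∫⁻ x in E, φ x ‖derivDensity hab hf x‖₊) +
    ∫⁻ x in E, recession φ x ∂(singularVariation hab hf)

/-- Jensen's inequality for one line: put s = |f'(x)| in the affine bound and integrate in dx, bound
the slope by (1 + ε)φ'_∞ and integrate against |D^s f|, and add. Since β ≥ 0, the total variation of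
Df on [u, v) may be replaced by the smaller |f(v) - f(u)|. -/
theorem affine_integral_le (hφ : IsConvexPhi (Icc a b) φ) (hd : DecWith (Icc a b) φ q)
    (hfl : ∀ x ∈ Ioc a b, ContinuousWithinAt f (Iic x) x) {u v : ℝ}
    (hu : a ≤ u) (huv : u ≤ v) (hv : v ≤ b) {α β ε : ℝ} (hβ : 0 ≤ β) (hε : 0 < ε)
    (hfin : relaxedEnergy φ hab hf (Ico u v) ≠ ∞)
    (h : ∀ x ∈ Ico u v, ∀ s, 0 ≤ s → α + β * s ≤ (1 + ε) * (realPhi φ x s + ε)) :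
    α * (v - u) + β * |f v - f u| ≤
      (1 + ε) * ((relaxedEnergy φ hab hf (Ico u v)).toReal + ε * (v - u)) := by
  have hsub : Ico u v ⊆ Icc a b := fun x hx => ⟨hu.trans hx.1, hx.2.le.trans hv⟩
  obtain ⟨hfin1, hfin2⟩ := ENNReal.add_ne_top.1 hfin
  set g := derivDensity hab hf with hg
  set μ := singularVariation hab hf with hμ
  have hgi : IntegrableOn (fun x => |g x|) (Ico u v) := integrable_derivDensity.abs.integrableOn
  have hvol : volume.real (Ico u v) = v - u := by
    rw [Measure.real, Real.volume_Ico, ENNReal.toReal_ofReal (by linarith)]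
  have hmeas : AEMeasurable (fun x => φ x ‖g x‖₊) (volume.restrict (Ico u v)) :=
    (hφ.measurable_comp (fun x => ‖g x‖₊)
      measurable_derivDensity.nnnorm.aemeasurable).mono_measure (Measure.restrict_mono hsub le_rfl)
  have hR : ∀ x, realPhi φ x |g x| = (φ x ‖g x‖₊).toReal := fun x => by
    rw [realPhi, Real.toNNReal_abs]; rfl
  have hRi : IntegrableOn (fun x => realPhi φ x |g x|) (Ico u v) := by
    simp only [hR]
    exact integrable_toReal_of_lintegral_ne_top hmeas hfin1
  have hRint : ∫ x in Ico u v, realPhi φ x |g x| = (∫⁻ x in Ico u v, φ x ‖g x‖₊).toReal := by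
    simp only [hR]
    exact integral_toReal hmeas (ae_lt_top' hmeas hfin1)
  have h1 : α * (v - u) + β * ∫ x in Ico u v, |g x| ≤
      (1 + ε) * ((∫⁻ x in Ico u v, φ x ‖g x‖₊).toReal + ε * (v - u)) := by
    have hci : ∀ c : ℝ, IntegrableOn (fun _ => c) (Ico u v) := fun c =>
      integrableOn_const (by simp)
    have := setIntegral_mono_on ((hci α).add (hgi.const_mul β))
      ((hRi.add (hci ε)).const_mul (1 + ε)) measurableSet_Ico
      (fun x hx => h x hx |g x| (abs_nonneg _))
    simp only [Pi.add_apply] at this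
    rw [integral_add (hci α) (hgi.const_mul β), integral_const_mul, integral_const_mul,
      integral_add hRi (hci ε), hRint] at this
    simp only [setIntegral_const, hvol, smul_eq_mul] at this
    linarith
  have h2 : β * μ.real (Ico u v) ≤
      (1 + ε) * (∫⁻ x in Ico u v, recession φ x ∂μ).toReal := by
    -- Measurability of φ'_∞ is not needed for monotonicity or for extracting a finite constant.
    have h3 : ∫⁻ x in Ico u v, ENNReal.ofReal β ∂μ ≤
        ∫⁻ x in Ico u v, ENNReal.ofReal (1 + ε) * recession φ x ∂μ :=
      setLIntegral_mono' measurableSet_Ico fun x hx =>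
        hφ.le_recession_of_affine_le hd (hsub hx) (by linarith) (h x hx)
    rw [lintegral_const_mul' _ _ ENNReal.ofReal_ne_top, setLIntegral_const] at h3
    have h4 := ENNReal.toReal_mono (by finiteness) h3
    rwa [ENNReal.toReal_mul, ENNReal.toReal_mul, ENNReal.toReal_ofReal hβ,
      ENNReal.toReal_ofReal (by linarith)] at h4
  have h3 := mul_le_mul_of_nonneg_left
    (abs_sub_le_integral_add (hab := hab) (hf := hf) hfl hu huv hv) hβ
  rw [relaxedEnergy, ENNReal.toReal_add hfin1 hfin2]
  rw [mul_add] at h3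
  linarith

/-- The upper bound for a single short interval. -/
theorem exists_realPhi_mul_le (hφ : IsConvexPhi (Icc a b) φ) (hd : DecWith (Icc a b) φ q)
    (hV : VA1 (Icc a b) φ)
    (hfl : ∀ x ∈ Ioc a b, ContinuousWithinAt f (Iic x) x) {ε M : ℝ} (hε : 0 < ε) (hM : 0 ≤ M) :
    ∃ h₀ > 0, ∀ u v, a ≤ u → u < v → v ≤ b → v - u < h₀ →
      relaxedEnergy φ hab hf (Ico u v) ≤ ENNReal.ofReal M → ∀ y ∈ Icc u v,
      realPhi φ y (|f v - f u| / (v - u)) * (v - u) ≤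
        (1 + ε) * ((relaxedEnergy φ hab hf (Ico u v)).toReal + ε * (v - u)) := by
  -- K strictly exceeds the bound (1 + ε)(M + ε) that the estimate yields for h < 1, so the level
  -- K/h is incompatible with it.
  set K := (1 + ε) * (M + ε) + 1 with hK
  have hKpos : 0 < K := by positivity
  obtain ⟨h₀, hh₀, hsup⟩ := hV.exists_support_le hφ hd hKpos hε
  refine ⟨min h₀ 1, by positivity, fun u v hu huv hv hlt hE y hy => ?_⟩
  have hyI : y ∈ Icc a b := ⟨hu.trans hy.1, hy.2.trans hv⟩
  have hlt₀ : v - u < h₀ := hlt.trans_le (min_le_left _ _)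
  have hlt1 : v - u < 1 := hlt.trans_le (min_le_right _ _)
  set h := v - u with hh
  have hpos : 0 < h := sub_pos.2 huv
  set E := relaxedEnergy φ hab hf (Ico u v) with hEdef
  have hE' : E.toReal ≤ M := by
    have := ENNReal.toReal_mono ENNReal.ofReal_ne_top hE
    rwa [ENNReal.toReal_ofReal hM] at this
  have hE0 : 0 ≤ E.toReal := ENNReal.toReal_nonneg
  -- Allowing every t up to the difference quotient costs nothing, since p(|Δf| - th) ≥ 0, and lets
  -- the estimate be tested at a smaller point below.
  have key : ∀ t, 0 < t → t ≤ |f v - f u| / h → realPhi φ y t ≤ K / h →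
      realPhi φ y t * h ≤ (1 + ε) * (E.toReal + ε * h) := by
    intro t ht htle htK
    obtain ⟨p, hp, hps⟩ := hd.realPhi_exists_support hφ hyI ht
    have := affine_integral_le (hab := hab) (hf := hf) (α := realPhi φ y t - p * t) (β := p)
      hφ hd hfl hu huv.le hv hp hε
      (ne_top_of_le_ne_top ENNReal.ofReal_ne_top hE) (fun x hx s hs => by
        have := hsup h hpos hlt₀ x ⟨hu.trans hx.1, hx.2.le.trans hv⟩ y hyI
          (by rw [abs_le]; constructor <;> linarith [hx.1, hx.2, hy.1, hy.2]) t p ht htK hp hps s hs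
        linarith)
    rw [le_div_iff₀ hpos] at htle
    have := mul_le_mul_of_nonneg_left htle hp
    linarith
  rcases (abs_nonneg (f v - f u)).eq_or_lt with h0 | h0
  · rw [← h0, zero_div, hφ.realPhi_zero hyI, zero_mul]
    positivity
  rcases le_or_gt (realPhi φ y (|f v - f u| / h)) (K / h) with hle | hgt
  · exact key _ (by positivity) le_rfl hle
  -- If φ(y, ·) exceeded K/h at the difference quotient, it would equal K/h at some smaller T, and
  -- `key` at T would give K ≤ (1 + ε)(M + ε).
  · exfalso
    obtain ⟨T, hT0, hT⟩ := hd.realPhi_exists_eq hφ hyI (s := 0) (M := K / h) le_rfl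
      (by rw [hφ.realPhi_zero hyI]; positivity)
    have hTlt : T ≤ |f v - f u| / h := by
      by_contra! hlt
      have := hd.realPhi_mono hφ.toIsWeakPhi hyI hlt.le
      linarith
    have hTpos : 0 < T := hT0.lt_of_ne (by
      rintro rfl
      rw [hφ.realPhi_zero hyI] at hT
      have : 0 < K / h := by positivity
      linarith)
    have := key T hTpos hTlt hT.le
    rw [hT, div_mul_cancel₀ _ hpos.ne'] at this
    have h2 : (1 + ε) * (E.toReal + ε * h) ≤ (1 + ε) * (M + ε) := by gcongr; nlinarith
    linarith

theorem exists_phiSup_mul_le (hφ : IsConvexPhi (Icc a b) φ) (hd : DecWith (Icc a b) φ q)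
    (hV : VA1 (Icc a b) φ)
    (hfl : ∀ x ∈ Ioc a b, ContinuousWithinAt f (Iic x) x) {ε M : ℝ} (hε : 0 < ε) (hM : 0 ≤ M) :
    ∃ h₀ > 0, ∀ u v, a ≤ u → u < v → v ≤ b → v - u < h₀ →
      relaxedEnergy φ hab hf (Ico u v) ≤ ENNReal.ofReal M →
      phiSup φ (Icc u v) (‖f u - f v‖₊ / (v - u).toNNReal) * (v - u).toNNReal ≤
        ENNReal.ofReal (1 + ε) *
          (relaxedEnergy φ hab hf (Ico u v) + ENNReal.ofReal ε * (v - u).toNNReal) := by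
  obtain ⟨h₀, hh₀, H⟩ := exists_realPhi_mul_le (hab := hab) (hf := hf) hφ hd hV hfl hε hM
  refine ⟨h₀, hh₀, fun u v hu huv hv hlt hE => ?_⟩
  have hpos : 0 < v - u := sub_pos.2 huv
  have ht : ‖f u - f v‖₊ / (v - u).toNNReal = (|f v - f u| / (v - u)).toNNReal := by
    rw [Real.toNNReal_div (abs_nonneg _), Real.toNNReal_abs, ← nnnorm_neg, neg_sub]; rfl
  rw [phiSup, ENNReal.iSup_mul]
  refine iSup_le fun y => ?_
  rw [ENNReal.iSup_mul]
  refine iSup_le fun hy => ?_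
  rw [ht, ← hd.coe_realPhi hφ.toIsWeakPhi ⟨hu.trans hy.1, hy.2.trans hv⟩]
  have hEt : relaxedEnergy φ hab hf (Ico u v) =
      ENNReal.ofReal (relaxedEnergy φ hab hf (Ico u v)).toReal :=
    (ENNReal.ofReal_toReal (ne_top_of_le_ne_top ENNReal.ofReal_ne_top hE)).symm
  rw [hEt]
  change _ * ENNReal.ofReal (v - u) ≤ _ * (_ + _ * ENNReal.ofReal (v - u))
  rw [← ENNReal.ofReal_mul (realPhi_nonneg _), ← ENNReal.ofReal_mul hε.le,
    ← ENNReal.ofReal_add ENNReal.toReal_nonneg (by positivity),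
    ← ENNReal.ofReal_mul (by linarith)]
  exact ENNReal.ofReal_le_ofReal (H u v hu huv hv hlt hE y hy)

/-! ### Summation over a partition -/

theorem sum_lintegral_Ico (μ : Measure ℝ) (g : ℝ → ℝ≥0∞) (p : ℕ → ℝ) {n : ℕ}
    (hp : ∀ k < n, p k ≤ p (k + 1)) :
    p 0 ≤ p n ∧ ∑ k ∈ Finset.range n, ∫⁻ x in Ico (p k) (p (k + 1)), g x ∂μ =
      ∫⁻ x in Ico (p 0) (p n), g x ∂μ := by
  induction n with
  | zero => simp
  | succ n ih =>
    obtain ⟨h1, h2⟩ := ih fun k hk => hp k (by omega)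
    have h3 := hp n (by omega)
    refine ⟨h1.trans h3, ?_⟩
    rw [Finset.sum_range_succ, h2, ← lintegral_union measurableSet_Ico
      (Ico_disjoint_Ico_same), Ico_union_Ico_eq_Ico h1 h3]

namespace Partition

variable (P : Partition a b)

theorem pt_le_pt {i j : ℕ} (hij : i ≤ j) (hj : j ≤ P.n) : P.pt i ≤ P.pt j := by
  induction j, hij using Nat.le_induction with
  | base => exact le_rfl
  | succ j hij ih => exact (ih (by omega)).trans (P.pt_lt j (by omega)).le

theorem sum_relaxedEnergy_le :
    ∑ k ∈ Finset.range P.n, relaxedEnergy φ hab hf (Ico (P.pt k) (P.pt (k + 1))) ≤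
      relaxedEnergy φ hab hf (Icc a b) := by
  simp only [relaxedEnergy]
  rw [Finset.sum_add_distrib, (sum_lintegral_Ico _ _ P.pt fun k hk => (P.pt_lt k hk).le).2,
    (sum_lintegral_Ico _ _ P.pt fun k hk => (P.pt_lt k hk).le).2, P.pt_zero, P.pt_last]
  gcongr <;> exact Ico_subset_Icc_self

theorem sum_len : ∑ k ∈ Finset.range P.n, (P.len k : ℝ≥0∞) = ENNReal.ofReal (b - a) := by
  have h := (sum_lintegral_Ico volume 1 P.pt fun k hk => (P.pt_lt k hk).le).2
  simpa [P.pt_zero, P.pt_last, len, ENNReal.ofReal] using h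

end Partition

/-- The total energy serves as the bound M for every subinterval, so one h₀ depending only on ε
works for all intervals of all fine partitions. -/
theorem limsupVariation_le (hφ : IsConvexPhi (Icc a b) φ) (hd : DecWith (Icc a b) φ q)
    (hV : VA1 (Icc a b) φ) (hfl : ∀ x ∈ Ioc a b, ContinuousWithinAt f (Iic x) x) :
    limsupVariation φ a b f ≤ relaxedEnergy φ hab hf (Icc a b) := by
  set R := relaxedEnergy φ hab hf (Icc a b) with hR
  rcases eq_or_ne R ∞ with htop | htop
  · rw [htop]; exact le_top
  have key : ∀ ε : ℝ, 0 < ε → limsupVariation φ a b f ≤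
      ENNReal.ofReal (1 + ε) * (R + ENNReal.ofReal ε * ENNReal.ofReal (b - a)) := by
    intro ε hε
    obtain ⟨h₀, hh₀, H⟩ := exists_phiSup_mul_le (hab := hab) (hf := hf) hφ hd hV hfl hε
      (M := R.toReal) ENNReal.toReal_nonneg
    have hev : ∀ᶠ P : Partition a b in comap Partition.mesh (𝓝 0), P.mesh < h₀.toNNReal :=
      (gt_mem_nhds (show 0 < h₀.toNNReal by simpa using hh₀)).comap Partition.mesh
    refine limsup_le_of_le (h := ?_)
    filter_upwards [hev] with P hP
    have hsum := P.sum_relaxedEnergy_le (φ := φ) (hab := hab) (hf := hf)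
    rw [← P.sum_len, Finset.mul_sum]
    refine le_trans ?_ (mul_le_mul_right (add_le_add_left hsum _) _)
    rw [← Finset.sum_add_distrib, Finset.mul_sum]
    refine Finset.sum_le_sum fun k hk => ?_
    have hk' := Finset.mem_range.1 hk
    refine H _ _ ?_ (P.pt_lt k hk') ?_ ?_ ?_
    · exact P.pt_zero.symm.le.trans (P.pt_le_pt (Nat.zero_le k) hk'.le)
    · exact (P.pt_le_pt hk' le_rfl).trans P.pt_last.le
    · have : P.len k < h₀.toNNReal := (Finset.le_sup (f := P.len) hk).trans_lt hP
      exact ((Real.toNNReal_lt_toNNReal_iff hh₀).1 this)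
    · rw [ENNReal.ofReal_toReal htop]
      exact (Finset.single_le_sum (f := fun k => relaxedEnergy φ hab hf
        (Ico (P.pt k) (P.pt (k + 1)))) (fun _ _ => zero_le) hk).trans hsum
  have hlim : Tendsto (fun ε : ℝ => ENNReal.ofReal (1 + ε) *
      (R + ENNReal.ofReal ε * ENNReal.ofReal (b - a))) (𝓝[>] 0) (𝓝 R) := by
    have h1 : Tendsto (fun ε : ℝ => ENNReal.ofReal (1 + ε)) (𝓝[>] 0) (𝓝 1) := by
      have : Tendsto (fun ε : ℝ => ENNReal.ofReal (1 + ε)) (𝓝 0) (𝓝 (ENNReal.ofReal (1 + 0))) :=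
        (ENNReal.continuous_ofReal.comp (continuous_const.add continuous_id)).tendsto 0
      simpa using this.mono_left nhdsWithin_le_nhds
    have h2 : Tendsto (fun ε : ℝ => ENNReal.ofReal ε) (𝓝[>] 0) (𝓝 0) := by
      simpa using (ENNReal.continuous_ofReal.tendsto 0).mono_left nhdsWithin_le_nhds
    have h3 := ENNReal.Tendsto.mul_const (b := ENNReal.ofReal (b - a)) h2
      (Or.inr ENNReal.ofReal_ne_top)
    have h4 := ENNReal.Tendsto.mul h1 (Or.inl one_ne_zero) (h3.const_add R)
      (Or.inr ENNReal.one_ne_top)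
    simpa using h4
  exact ge_of_tendsto hlim (eventually_mem_nhdsWithin.mono fun ε hε => key ε hε)

end Upper

/-! ### Differentiation along a dyadic grid -/

section Grid

/-- The index of the half-open cell of the `n`-th dyadic grid containing `x`, where the cells of
the `0`-th grid are the translates of `[a, a + L)` by multiples of `L`. -/
noncomputable def gridIndex (a L : ℝ) (n : ℕ) (x : ℝ) : ℤ := ⌊(x - a) / L * 2 ^ n⌋

variable {a L : ℝ}

theorem measurable_gridIndex (n : ℕ) : Measurable (gridIndex a L n) := by
  unfold gridIndex
  fun_prop

/-- The cells are nested: ⌊z/2⌋ depends only on ⌊z⌋. -/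
theorem gridIndex_eq_succ_div (n : ℕ) (x : ℝ) :
    gridIndex a L n x = gridIndex a L (n + 1) x / 2 := by
  have h := Int.floor_div_natCast ((x - a) / L * 2 ^ (n + 1)) 2
  rw [gridIndex, gridIndex]
  push_cast at h
  rw [← h]
  congr 1
  ring

/-- The filtration generated by the dyadic grids. -/
noncomputable def gridFiltration (a L : ℝ) : Filtration ℕ (borel ℝ) where
  seq n := MeasurableSpace.comap (gridIndex a L n) ⊤
  mono' := by
    refine monotone_nat_of_le_succ fun n => ?_
    have h : gridIndex a L n = (fun k : ℤ => k / 2) ∘ gridIndex a L (n + 1) :=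
      funext fun x => gridIndex_eq_succ_div n x
    rw [h, ← MeasurableSpace.comap_comp]
    exact MeasurableSpace.comap_mono le_top
  le' n := (measurable_gridIndex n).comap_le

/-- The left endpoint of the n-th cell containing x is measurable for the filtration and converges
to x, so the identity is measurable for the generated σ-algebra. -/
theorem borel_le_iSup_gridFiltration (hL : 0 < L) : borel ℝ ≤ ⨆ n, gridFiltration a L n := by
  have hmeas : ∀ n, Measurable[⨆ n, gridFiltration a L n]
      (fun x => a + gridIndex a L n x / 2 ^ n * L) := by
    intro n
    have h1 : Measurable[⨆ n, gridFiltration a L n, ⊤] (gridIndex a L n) :=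
      Measurable.mono (comap_measurable (m := ⊤) (gridIndex a L n))
        (le_iSup (fun n => gridFiltration a L n) n) le_rfl
    exact (measurable_from_top (f := fun k : ℤ => a + (k : ℝ) / 2 ^ n * L)).comp h1
  have hlim : Tendsto (fun n x => a + gridIndex a L n x / 2 ^ n * L) atTop (𝓝 (id : ℝ → ℝ)) := by
    refine tendsto_pi_nhds.2 fun x => ?_
    have h2 : Tendsto (fun n : ℕ => ((2 : ℝ) ^ n)) atTop atTop :=
      tendsto_pow_atTop_atTop_of_one_lt one_lt_two
    have h3 : Tendsto (fun n => (gridIndex a L n x : ℝ) / 2 ^ n) atTop (𝓝 ((x - a) / L)) := by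
      have h5 : Tendsto (fun n : ℕ => (x - a) / L - ((2 : ℝ) ^ n)⁻¹) atTop (𝓝 ((x - a) / L)) := by
        simpa using (tendsto_inv_atTop_zero.comp h2).const_sub ((x - a) / L)
      refine tendsto_of_tendsto_of_tendsto_of_le_of_le h5 tendsto_const_nhds
        (fun n => ?_) fun n => ?_
      · have := Int.lt_floor_add_one ((x - a) / L * 2 ^ n)
        rw [gridIndex, le_div_iff₀ (by positivity), sub_mul, inv_mul_cancel₀ (by positivity)]
        linarith
      · rw [div_le_iff₀ (by positivity)]
        exact Int.floor_le _
    have h4 := (h3.mul_const L).const_add a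
    rw [div_mul_cancel₀ _ hL.ne', add_sub_cancel] at h4
    exact h4
  have hid := @measurable_of_tendsto_metrizable _ _ (⨆ n, gridFiltration a L n) _ _ _ _ _ _ hmeas
    hlim
  intro s hs
  exact hid hs

/-- Averages of an integrable function over the cells of the dyadic grids. -/
theorem condExp_mul_measureReal_cell (ν : Measure ℝ) [IsFiniteMeasure ν] {g : ℝ → ℝ}
    (hg : Integrable g ν) (n : ℕ) (x : ℝ) :
    (ν[g | gridFiltration a L n]) x * ν.real (gridIndex a L n ⁻¹' {gridIndex a L n x}) =
      ∫ y in gridIndex a L n ⁻¹' {gridIndex a L n x}, g y ∂ν := by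
  have hle : gridFiltration a L n ≤ borel ℝ := (gridFiltration a L).le n
  have hs : MeasurableSet[gridFiltration a L n] (gridIndex a L n ⁻¹' {gridIndex a L n x}) :=
    ⟨_, trivial, rfl⟩
  rw [← setIntegral_condExp (m₀ := borel ℝ) hle hg hs]
  -- Measurability for the σ-algebra pulled back by the index forces the conditional expectation to
  -- be constant on cells.
  have hfac : (ν[g | gridFiltration a L n]).FactorsThrough (gridIndex a L n) :=
    StronglyMeasurable.factorsThrough (mY := ⊤)
      (stronglyMeasurable_condExp (m := gridFiltration a L n) (μ := ν) (f := g))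
  rw [setIntegral_congr_fun (g := fun _ => (ν[g | gridFiltration a L n]) x)
    (measurable_gridIndex n (measurableSet_singleton _)) (fun y hy => hfac hy),
    setIntegral_const, smul_eq_mul, mul_comm]

/-- **Lebesgue differentiation** along dyadic grids. -/
theorem ae_tendsto_average_cell (hL : 0 < L) (ν : Measure ℝ) [IsFiniteMeasure ν] {g : ℝ → ℝ}
    (hg : Integrable g ν) (hgm : Measurable g) :
    ∀ᵐ x ∂ν, (∀ n, ν.real (gridIndex a L n ⁻¹' {gridIndex a L n x}) ≠ 0) →
      Tendsto (fun n => (∫ y in gridIndex a L n ⁻¹' {gridIndex a L n x}, g y ∂ν) /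
        ν.real (gridIndex a L n ⁻¹' {gridIndex a L n x})) atTop (𝓝 (g x)) := by
  -- Lévy's upward theorem; the limit is g itself because g is measurable for the σ-algebra
  -- generated by all the grids.
  have h := hg.tendsto_ae_condExp (ℱ := gridFiltration a L)
    ((hgm.mono (borel_le_iSup_gridFiltration hL) le_rfl).stronglyMeasurable)
  filter_upwards [h] with x hx hne
  refine hx.congr fun n => ?_
  rw [← condExp_mul_measureReal_cell ν hg, mul_div_cancel_right₀ _ (hne n)]

/-- The `k`-th point of the `n`-th dyadic grid. -/
noncomputable def gridPoint (a L : ℝ) (n : ℕ) (k : ℤ) : ℝ := a + k * (L / 2 ^ n)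

theorem gridIndex_preimage (hL : 0 < L) (n : ℕ) (k : ℤ) :
    gridIndex a L n ⁻¹' {k} = Ico (gridPoint a L n k) (gridPoint a L n (k + 1)) := by
  ext x
  have h2 : (0 : ℝ) < 2 ^ n := by positivity
  have hd : 0 < L / 2 ^ n := by positivity
  have he : (x - a) / L * 2 ^ n = (x - a) / (L / 2 ^ n) := by field_simp
  rw [mem_preimage, mem_singleton_iff, gridIndex, Int.floor_eq_iff, he, le_div_iff₀ hd,
    div_lt_iff₀ hd, mem_Ico, gridPoint, gridPoint]
  push_cast
  constructor <;> rintro ⟨h1, h2⟩ <;> constructor <;> linarith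

theorem gridIndex_mem_Ico (hL : 0 < L) (n : ℕ) {x : ℝ} (hx : x ∈ Ico a (a + L)) :
    0 ≤ gridIndex a L n x ∧ gridIndex a L n x < 2 ^ n := by
  have h2 : (0 : ℝ) < 2 ^ n := by positivity
  have h0 : 0 ≤ (x - a) / L := div_nonneg (by linarith [hx.1]) hL.le
  have h1 : (x - a) / L < 1 := by rw [div_lt_one hL]; linarith [hx.2]
  constructor
  · exact Int.floor_nonneg.2 (by positivity)
  · rw [gridIndex, Int.floor_lt]
    push_cast
    nlinarith

end Grid

/-- The partition of `[a, b]` into `2 ^ n` intervals of equal length. -/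
noncomputable def dyadicPartition {a b : ℝ} (hab : a < b) (n : ℕ) : Partition a b where
  n := 2 ^ n
  pt k := gridPoint a (b - a) n k
  pt_zero := by simp [gridPoint]
  pt_last := by simp [gridPoint, mul_div_cancel₀]
  pt_lt k _ := by
    have : 0 < (b - a) / 2 ^ n := div_pos (sub_pos.2 hab) (by positivity)
    simp only [gridPoint]
    push_cast
    linarith

theorem dyadicPartition_len {a b : ℝ} (hab : a < b) (n k : ℕ) :
    (dyadicPartition hab n).len k = ((b - a) / 2 ^ n).toNNReal := by
  simp only [Partition.len, dyadicPartition, gridPoint]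
  push_cast
  congr 1
  ring

theorem tendsto_mesh_dyadicPartition {a b : ℝ} (hab : a < b) :
    Tendsto (fun n => (dyadicPartition hab n).mesh) atTop (𝓝 0) := by
  have h : Tendsto (fun n : ℕ => ((b - a) / 2 ^ n).toNNReal) atTop (𝓝 0) := by
    have h1 : Tendsto (fun n : ℕ => (b - a) / 2 ^ n) atTop (𝓝 0) :=
      tendsto_const_nhds.div_atTop (tendsto_pow_atTop_atTop_of_one_lt one_lt_two)
    have h2 := (continuous_real_toNNReal.tendsto 0).comp h1
    rwa [Real.toNNReal_zero] at h2
  refine tendsto_of_tendsto_of_tendsto_of_le_of_le tendsto_const_nhds h (fun _ => zero_le)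
    fun n => Finset.sup_le fun k _ => (dyadicPartition_len hab n k).le

/-! ### The lower bound -/

section Lower

variable {a b : ℝ} {f : ℝ → ℝ} {φ : ℝ → ℝ≥0 → ℝ≥0∞} {q : ℝ}

/-- The singular part of the derivative measure is carried by a Lebesgue null set and has a sign
with respect to its total variation. -/
theorem exists_sign_singularPart (hab : a ≤ b) (hf : BoundedVariationOn f (Icc a b)) :
    ∃ (N : Set ℝ) (σ : ℝ → ℝ), MeasurableSet N ∧ volume N = 0 ∧ singularVariation hab hf Nᶜ = 0 ∧
      Measurable σ ∧ (∀ x, |σ x| = 1) ∧ ∀ E, MeasurableSet E →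
        (derivMeasure hab hf).singularPart volume E = ∫ x in E, σ x ∂(singularVariation hab hf) := by
  set s := (derivMeasure hab hf).singularPart volume with hs
  have hms : singularVariation hab hf ⟂ₘ volume := by
    have h := SignedMeasure.mutuallySingular_singularPart (derivMeasure hab hf) volume
    rwa [SignedMeasure.mutuallySingular_ennreal_iff,
      VectorMeasure.ennrealToMeasure_toENNRealVectorMeasure] at h
  -- Hahn decomposition: the positive part vanishes on S and the negative part off S, hence the sign
  -- -1 on S.
  obtain ⟨S, hS, -, -, hpos, hneg⟩ := s.toJordanDecomposition.exists_compl_positive_negative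
  classical
  refine ⟨hms.nullSetᶜ, S.piecewise (-1) 1, hms.measurableSet_nullSet.compl,
    hms.measure_compl_nullSet, by rw [compl_compl]; exact hms.measure_nullSet,
    measurable_one.neg.piecewise hS measurable_one, fun x => ?_, fun E hE => ?_⟩
  · by_cases hx : x ∈ S <;> simp [hx]
  · have h1 : S.piecewise (-1) 1 =ᵐ[s.toJordanDecomposition.posPart] fun _ => (1 : ℝ) := by
      have : ∀ᵐ x ∂s.toJordanDecomposition.posPart, x ∉ S := by
        rw [ae_iff]; simpa using hpos
      filter_upwards [this] with x hx
      simp [hx]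
    have h2 : S.piecewise (-1) 1 =ᵐ[s.toJordanDecomposition.negPart] fun _ => (-1 : ℝ) := by
      have : ∀ᵐ x ∂s.toJordanDecomposition.negPart, x ∈ S := by
        rw [ae_iff]; exact hneg
      filter_upwards [this] with x hx
      simp [hx]
    have h1' := ae_restrict_of_ae (s := E) h1
    have h2' := ae_restrict_of_ae (s := E) h2
    rw [SignedMeasure.apply_eq_posPart_real_sub_negPart_real _ hE, singularVariation,
      SignedMeasure.totalVariation, Measure.restrict_add, integral_add_measure
      ((integrable_const _).congr (EventuallyEq.symm h1')) ((integrable_const _).congr (EventuallyEq.symm h2')),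
      integral_congr_ae h1', integral_congr_ae h2']
    simp [sub_eq_add_neg]

theorem derivMeasure_singleton_right (hab : a ≤ b) (hf : BoundedVariationOn f (Icc a b))
    (hfl : ∀ x ∈ Ioc a b, ContinuousWithinAt f (Iic x) x) : derivMeasure hab hf {b} = 0 := by
  have h : (constExtend hab f).rightLim b = f b := by
    have hval : constExtend hab f b = f b := by simp [constExtend, projIcc_right]
    rw [← hval]
    refine ContinuousWithinAt.rightLim_eq ((continuousWithinAt_const (b := f b)).congr
      (fun y hy => ?_) hval)
    simp [constExtend, projIcc_of_right_le hab (mem_Ici.1 hy)]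
  rw [derivMeasure, BoundedVariationOn.vectorMeasure_singleton, h,
    leftLim_constExtend hab hfl ⟨hab, le_rfl⟩, sub_self]

/-- The point b is Lebesgue null, so 0 = Df({b}) = σ(b)|D^s f|({b}) with σ(b) ≠ 0. Hence nothing is
lost when the grid cells cover only [a, b). -/
theorem singularVariation_singleton_right (hab : a ≤ b) (hf : BoundedVariationOn f (Icc a b))
    (hfl : ∀ x ∈ Ioc a b, ContinuousWithinAt f (Iic x) x) : singularVariation hab hf {b} = 0 := by
  obtain ⟨N, σ, -, -, -, -, hσ, hE⟩ := exists_sign_singularPart hab hf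
  have h := derivMeasure_apply (hab := hab) (hf := hf) (measurableSet_singleton b)
  rw [derivMeasure_singleton_right hab hf hfl, hE _ (measurableSet_singleton b)] at h
  simp only [Measure.restrict_singleton, integral_smul_measure, integral_dirac] at h
  have hb : σ b ≠ 0 := fun h0 => by simpa [h0] using hσ b
  have h' : (singularVariation hab hf {b}).toReal = 0 := by simpa [hb] using h
  exact (ENNReal.toReal_eq_zero_iff _).1 h' |>.resolve_right (measure_ne_top _ _)

/-- The two limits of the perspective function φ(x, d/c)c needed for the lower bound: c → 1 at
points of the absolutely continuous part, and c → 0, d → 1 at points of the singular part, treated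
next. -/
theorem IsConvexPhi.tendsto_mul_of_tendsto_one (hφ : IsConvexPhi (Icc a b) φ)
    (hd : DecWith (Icc a b) φ q) {x : ℝ} (hx : x ∈ Icc a b) {c d : ℕ → ℝ} {D : ℝ}
    (hc : Tendsto c atTop (𝓝 1)) (hdt : Tendsto d atTop (𝓝 D)) :
    Tendsto (fun n => φ x (d n / c n).toNNReal * ENNReal.ofReal (c n)) atTop
      (𝓝 (φ x D.toNNReal)) := by
  have h1 : Tendsto (fun n => φ x (d n / c n).toNNReal) atTop (𝓝 (φ x D.toNNReal)) := by
    have h := hdt.div hc one_ne_zero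
    rw [div_one] at h
    exact (((hφ.continuous hd hx).comp continuous_real_toNNReal).tendsto D).comp h
  have h2 : Tendsto (fun n => ENNReal.ofReal (c n)) atTop (𝓝 1) := by
    simpa using ENNReal.tendsto_ofReal hc
  simpa using ENNReal.Tendsto.mul h1 (Or.inr ENNReal.one_ne_top) h2 (Or.inl one_ne_zero)

theorem IsConvexPhi.tendsto_mul_of_tendsto_zero (hφ : IsConvexPhi (Icc a b) φ)
    (hd : DecWith (Icc a b) φ q) {x : ℝ} (hx : x ∈ Icc a b) {c d : ℕ → ℝ} (hcpos : ∀ n, 0 < c n)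
    (hc : Tendsto c atTop (𝓝 0)) (hdt : Tendsto d atTop (𝓝 1)) :
    Tendsto (fun n => φ x (d n / c n).toNNReal * ENNReal.ofReal (c n)) atTop
      (𝓝 (recession φ x)) := by
  have hc' : Tendsto c atTop (𝓝[>] 0) :=
    tendsto_nhdsWithin_iff.2 ⟨hc, Eventually.of_forall hcpos⟩
  have ht : Tendsto (fun n => (d n / c n).toNNReal) atTop atTop :=
    tendsto_real_toNNReal_atTop.comp (hdt.pos_mul_atTop one_pos hc'.inv_tendsto_nhdsGT_zero)
  have h1 := (hφ.tendsto_recession hd hx).comp ht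
  have h2 : Tendsto (fun n => ENNReal.ofReal (d n)) atTop (𝓝 1) := by
    simpa using ENNReal.tendsto_ofReal hdt
  have h3 := ENNReal.Tendsto.mul h1 (Or.inr ENNReal.one_ne_top) h2 (Or.inl one_ne_zero)
  rw [mul_one] at h3
  refine h3.congr' ?_
  filter_upwards [hdt.eventually (lt_mem_nhds one_pos)] with n hn
  have hq : 0 < d n / c n := div_pos hn (hcpos n)
  -- With t = d/c the product φ(x, t)c equals (φ(x, t)/t)d, where t → ∞.
  have hdn : ENNReal.ofReal (d n) = ENNReal.ofReal (d n / c n) * ENNReal.ofReal (c n) := by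
    rw [← ENNReal.ofReal_mul hq.le, div_mul_cancel₀ _ (hcpos n).ne']
  rw [Function.comp_apply, hdn, ← mul_assoc]
  congr 1
  exact ENNReal.div_mul_cancel (by simpa using hq) ENNReal.coe_ne_top

/-- The integrand whose integral over the `n`-th dyadic grid is the Riesz sum. -/
noncomputable def rieszDensity (φ : ℝ → ℝ≥0 → ℝ≥0∞) (f : ℝ → ℝ) (a L : ℝ) (ν : Measure ℝ) (n : ℕ)
    (k : ℤ) : ℝ≥0∞ :=
  phiSup φ (Icc (gridPoint a L n k) (gridPoint a L n (k + 1)))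
    (‖f (gridPoint a L n k) - f (gridPoint a L n (k + 1))‖₊ / (L / 2 ^ n).toNNReal) *
    ENNReal.ofReal (L / 2 ^ n / ν.real (Ico (gridPoint a L n k) (gridPoint a L n (k + 1))))

theorem gridPoint_succ_sub (a L : ℝ) (n : ℕ) (k : ℤ) :
    gridPoint a L n (k + 1) - gridPoint a L n k = L / 2 ^ n := by
  simp only [gridPoint]; push_cast; ring

theorem gridPoint_mem_Icc (hab : a < b) (n : ℕ) {k : ℤ} (hk0 : 0 ≤ k) (hk : k ≤ 2 ^ n) :
    gridPoint a (b - a) n k ∈ Icc a b := by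
  have hd : 0 < (b - a) / 2 ^ n := div_pos (sub_pos.2 hab) (by positivity)
  have h0 : (0 : ℝ) ≤ k := by exact_mod_cast hk0
  have h1 : (k : ℝ) ≤ 2 ^ n := by exact_mod_cast hk
  have h2 : (k : ℝ) * ((b - a) / 2 ^ n) ≤ 2 ^ n * ((b - a) / 2 ^ n) := by gcongr
  rw [mul_div_cancel₀ _ (by positivity)] at h2
  rw [gridPoint]
  constructor
  · nlinarith
  · linarith

theorem lintegral_rieszDensity (hab : a < b) (ν : Measure ℝ) [IsFiniteMeasure ν]
    (hν : ∀ u v, a ≤ u → u < v → v ≤ b → 0 < ν (Ico u v)) (n : ℕ) :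
    ∫⁻ x in Ico a b, rieszDensity φ f a (b - a) ν n (gridIndex a (b - a) n x) ∂ν =
      (dyadicPartition hab n).rieszSum φ f := by
  set P := dyadicPartition hab n with hP
  have hL : 0 < b - a := sub_pos.2 hab
  have h := (sum_lintegral_Ico ν
    (fun x => rieszDensity φ f a (b - a) ν n (gridIndex a (b - a) n x)) P.pt
    fun k hk => (P.pt_lt k hk).le).2
  rw [P.pt_zero, P.pt_last] at h
  rw [← h, Partition.rieszSum]
  refine Finset.sum_congr rfl fun k hk => ?_
  have hk' : k < 2 ^ n := Finset.mem_range.1 hk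
  have hpt : ∀ j, P.pt j = gridPoint a (b - a) n j := fun _ => rfl
  have hpt' : P.pt (k + 1) = gridPoint a (b - a) n ((k : ℤ) + 1) := by rw [hpt]; push_cast; rfl
  have hpos := hν (P.pt k) (P.pt (k + 1))
    (gridPoint_mem_Icc hab n (by positivity) (by exact_mod_cast hk'.le)).1 (P.pt_lt k hk')
    (gridPoint_mem_Icc hab n (by positivity) (by exact_mod_cast hk')).2
  rw [setLIntegral_congr_fun (g := fun _ => rieszDensity φ f a (b - a) ν n k) measurableSet_Ico
    (fun x hx => by
      rw [hpt, hpt', ← gridIndex_preimage hL] at hx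
      rw [mem_preimage, mem_singleton_iff] at hx
      simp only [hx]), setLIntegral_const, dyadicPartition_len, hpt', hpt, rieszDensity, mul_assoc]
  congr 1
  rw [hpt', hpt] at hpos
  rw [← ENNReal.ofReal_toReal (measure_ne_top ν (Ico _ _)), ← Measure.real,
    ← ENNReal.ofReal_mul (by positivity), div_mul_cancel₀]
  · rfl
  · exact (ENNReal.toReal_pos hpos.ne' (measure_ne_top _ _)).ne'

theorem relaxedEnergy_le_limsupVariation (hab : a < b) (hf : BoundedVariationOn f (Icc a b))
    (hφ : IsConvexPhi (Icc a b) φ) (hd : DecWith (Icc a b) φ q)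
    (hfl : ∀ x ∈ Ioc a b, ContinuousWithinAt f (Iic x) x) :
    relaxedEnergy φ hab.le hf (Icc a b) ≤ limsupVariation φ a b f := by
  classical
  have hL : 0 < b - a := sub_pos.2 hab
  obtain ⟨N, σ, hN, hN0, hNc, hσm, hσ, hσE⟩ := exists_sign_singularPart hab.le hf
  set μ := singularVariation hab.le hf with hμ
  set g := derivDensity hab.le hf with hg
  set ν : Measure ℝ := volume.restrict (Ico a b) + μ with hν
  -- On [a, b), g₁ and g₂ are the densities of Lebesgue measure and of Df with respect to ν, and G
  -- is the target integrand. All three are defined by cases on N, which is null for Lebesgue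
  -- measure and carries |D^s f|.
  set g₁ : ℝ → ℝ := N.piecewise 0 1 with hg₁
  set g₂ : ℝ → ℝ := N.piecewise σ g with hg₂
  set G : ℝ → ℝ≥0∞ := N.piecewise (recession φ) (fun x => φ x ‖g x‖₊) with hG
  have hNvol : ∀ᵐ x : ℝ, x ∉ N := by rw [ae_iff]; simpa using hN0
  have hNμ : ∀ᵐ x ∂μ, x ∈ N := by rw [ae_iff]; exact hNc
  have hg₁v : g₁ =ᵐ[volume] fun _ => 1 := hNvol.mono fun x hx => by simp [hg₁, hx]
  have hg₁μ : g₁ =ᵐ[μ] fun _ => 0 := hNμ.mono fun x hx => by simp [hg₁, hx]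
  have hg₂v : g₂ =ᵐ[volume] g := hNvol.mono fun x hx => by simp [hg₂, hx]
  have hg₂μ : g₂ =ᵐ[μ] σ := hNμ.mono fun x hx => by simp [hg₂, hx]
  have hGv : G =ᵐ[volume] fun x => φ x ‖g x‖₊ := hNvol.mono fun x hx => by simp [hG, hx]
  have hGμ : G =ᵐ[μ] recession φ := hNμ.mono fun x hx => by simp [hG, hx]
  have hg₁m : Measurable g₁ := measurable_const.piecewise hN measurable_const
  have hg₂m : Measurable g₂ := hσm.piecewise hN measurable_derivDensity
  have hσi : Integrable σ μ :=
    Integrable.of_bound hσm.aestronglyMeasurable 1 (Eventually.of_forall fun x => (hσ x).le)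
  have hg₁v' : Integrable g₁ (volume.restrict (Ico a b)) :=
    (integrable_const (1 : ℝ)).congr (EventuallyEq.symm (ae_restrict_of_ae hg₁v))
  have hg₁μ' : Integrable g₁ μ := (integrable_const (0 : ℝ)).congr hg₁μ.symm
  have hg₂v' : Integrable g₂ (volume.restrict (Ico a b)) :=
    integrable_derivDensity.restrict.congr (EventuallyEq.symm (ae_restrict_of_ae hg₂v))
  have hg₂μ' : Integrable g₂ μ := hσi.congr hg₂μ.symm
  have hνrestrict : ∀ u v, a ≤ u → v ≤ b →
      ν.restrict (Ico u v) = volume.restrict (Ico u v) + μ.restrict (Ico u v) := fun u v hu hv => by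
    rw [hν, Measure.restrict_add, Measure.restrict_restrict measurableSet_Ico,
      inter_eq_left.2 (Ico_subset_Ico hu hv)]
  have hint₁ : ∀ u v, a ≤ u → u ≤ v → v ≤ b → ∫ x in Ico u v, g₁ x ∂ν = v - u := by
    intro u v hu huv hv
    rw [hνrestrict u v hu hv, integral_add_measure
      (hg₁v'.mono_measure (Measure.restrict_mono (Ico_subset_Ico hu hv) le_rfl)) hg₁μ'.restrict,
      integral_congr_ae (ae_restrict_of_ae hg₁v), integral_congr_ae (ae_restrict_of_ae hg₁μ)]
    simp [Measure.real, huv]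
  have hint₂ : ∀ u v, a ≤ u → u ≤ v → v ≤ b → ∫ x in Ico u v, g₂ x ∂ν = f v - f u := by
    intro u v hu huv hv
    rw [hνrestrict u v hu hv, integral_add_measure
      (hg₂v'.mono_measure (Measure.restrict_mono (Ico_subset_Ico hu hv) le_rfl)) hg₂μ'.restrict,
      integral_congr_ae (ae_restrict_of_ae hg₂v), integral_congr_ae (ae_restrict_of_ae hg₂μ),
      ← hσE _ measurableSet_Ico, add_comm, ← derivMeasure_apply measurableSet_Ico,
      derivMeasure_Ico_of_le hfl hu huv hv]
  have hνpos : ∀ u v, a ≤ u → u < v → v ≤ b → 0 < ν (Ico u v) := by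
    intro u v hu huv hv
    have h : volume (Ico u v) ≤ ν (Ico u v) := by
      rw [← Measure.restrict_apply_univ (μ := ν), hνrestrict u v hu hv, Measure.add_apply,
        Measure.restrict_apply_univ]
      exact le_self_add
    exact lt_of_lt_of_le (by simpa using huv) h
  have hpointwise : ∀ᵐ x ∂(ν.restrict (Ico a b)), G x ≤
      liminf (fun n => rieszDensity φ f a (b - a) ν n (gridIndex a (b - a) n x)) atTop := by
    rw [ae_restrict_iff' measurableSet_Ico]
    filter_upwards [ae_tendsto_average_cell (a := a) hL ν (hg₁v'.add_measure hg₁μ') hg₁m,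
      ae_tendsto_average_cell (a := a) hL ν (hg₂v'.add_measure hg₂μ') hg₂m] with x h₁ h₂ hx
    have hxI : x ∈ Icc a b := Ico_subset_Icc_self hx
    set k : ℕ → ℤ := fun n => gridIndex a (b - a) n x with hk
    set u : ℕ → ℝ := fun n => gridPoint a (b - a) n (k n) with hu
    set v : ℕ → ℝ := fun n => gridPoint a (b - a) n (k n + 1) with hv
    have hcell : ∀ n, gridIndex a (b - a) n ⁻¹' {gridIndex a (b - a) n x} = Ico (u n) (v n) :=
      fun n => gridIndex_preimage hL n _
    have hkb := fun n => gridIndex_mem_Ico (a := a) hL n (x := x) (by simpa using hx)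
    have hau : ∀ n, a ≤ u n := fun n => (gridPoint_mem_Icc hab n (hkb n).1 (hkb n).2.le).1
    have hvb : ∀ n, v n ≤ b := fun n =>
      (gridPoint_mem_Icc hab n (by have := (hkb n).1; simp only [hk]; omega)
        (by have := (hkb n).2; simp only [hk]; omega)).2
    have hlen : ∀ n, v n - u n = (b - a) / 2 ^ n := fun n => gridPoint_succ_sub _ _ _ _
    have hlenpos : ∀ n, 0 < (b - a) / 2 ^ n := fun n => by positivity
    have huv : ∀ n, u n < v n := fun n => by have := hlen n; have := hlenpos n; linarith
    have hxuv : ∀ n, x ∈ Icc (u n) (v n) := fun n => by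
      have : x ∈ gridIndex a (b - a) n ⁻¹' {gridIndex a (b - a) n x} := rfl
      rw [hcell] at this
      exact Ico_subset_Icc_self this
    have hνr : ∀ n, 0 < ν.real (Ico (u n) (v n)) := fun n =>
      ENNReal.toReal_pos (hνpos _ _ (hau n) (huv n) (hvb n)).ne' (measure_ne_top _ _)
    simp only [hcell] at h₁ h₂
    have h₁' := h₁ fun n => (hνr n).ne'
    have h₂' := (h₂ fun n => (hνr n).ne').abs
    simp only [hint₁ _ _ (hau _) (huv _).le (hvb _), hint₂ _ _ (hau _) (huv _).le (hvb _),
      abs_div, abs_of_pos (hνr _)] at h₁' h₂'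
    set c : ℕ → ℝ := fun n => (v n - u n) / ν.real (Ico (u n) (v n)) with hc
    set d : ℕ → ℝ := fun n => |f (v n) - f (u n)| / ν.real (Ico (u n) (v n)) with hd'
    have hcpos : ∀ n, 0 < c n := fun n => div_pos (sub_pos.2 (huv n)) (hνr n)
    -- The supremum over the cell dominates the value at x, which lies in the cell.
    have hle : ∀ n, φ x (d n / c n).toNNReal * ENNReal.ofReal (c n) ≤
        rieszDensity φ f a (b - a) ν n (gridIndex a (b - a) n x) := by
      intro n
      have h1 : (d n / c n).toNNReal = ‖f (u n) - f (v n)‖₊ / ((b - a) / 2 ^ n).toNNReal := by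
        rw [hd', hc]
        simp only
        rw [div_div_div_cancel_right₀ (hνr n).ne', hlen, Real.toNNReal_div (abs_nonneg _),
          Real.toNNReal_abs, ← nnnorm_neg, neg_sub]
        rfl
      rw [rieszDensity, h1, hc]
      simp only [hlen]
      gcongr
      exact le_iSup₂ (f := fun y (_ : y ∈ Icc (u n) (v n)) =>
        φ y (‖f (u n) - f (v n)‖₊ / ((b - a) / 2 ^ n).toNNReal)) x (hxuv n)
    refine le_trans (le_of_eq ?_) (liminf_le_liminf (Eventually.of_forall hle))
    by_cases hxN : x ∈ N
    · have e1 : g₁ x = 0 := by simp [hg₁, hxN]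
      have e2 : |g₂ x| = 1 := by simp [hg₂, hxN, hσ]
      rw [e1] at h₁'
      rw [e2] at h₂'
      rw [(hφ.tendsto_mul_of_tendsto_zero hd hxI hcpos h₁' h₂').liminf_eq]
      simp [hG, hxN]
    · have e1 : g₁ x = 1 := by simp [hg₁, hxN]
      have e2 : |g₂ x| = |g x| := by simp [hg₂, hxN]
      rw [e1] at h₁'
      rw [e2] at h₂'
      rw [(hφ.tendsto_mul_of_tendsto_one hd hxI h₁' h₂').liminf_eq, Real.toNNReal_abs]
      simp only [hG, hxN, not_false_eq_true, piecewise_eq_of_notMem]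
      rfl
  have hleft : relaxedEnergy φ hab.le hf (Icc a b) = ∫⁻ x in Ico a b, G x ∂ν := by
    rw [hνrestrict a b le_rfl le_rfl, lintegral_add_measure,
      lintegral_congr_ae (ae_restrict_of_ae hGv), lintegral_congr_ae (ae_restrict_of_ae hGμ),
      relaxedEnergy, setLIntegral_congr Ico_ae_eq_Icc.symm]
    congr 1
    exact setLIntegral_congr (Ico_ae_eq_Icc'
      (singularVariation_singleton_right hab.le hf hfl)).symm
  calc relaxedEnergy φ hab.le hf (Icc a b) = ∫⁻ x in Ico a b, G x ∂ν := hleft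
    _ ≤ ∫⁻ x in Ico a b, liminf (fun n =>
          rieszDensity φ f a (b - a) ν n (gridIndex a (b - a) n x)) atTop ∂ν :=
        lintegral_mono_ae hpointwise
    _ ≤ liminf (fun n => ∫⁻ x in Ico a b,
          rieszDensity φ f a (b - a) ν n (gridIndex a (b - a) n x) ∂ν) atTop :=
        -- Fatou's lemma applies without regularity of φ in x: each integrand is a function of the
        -- integer index of the cell.
        lintegral_liminf_le fun n => (measurable_from_top (f := rieszDensity φ f a (b - a) ν n)).comp
          (measurable_gridIndex n)
    _ = liminf (fun n => (dyadicPartition hab n).rieszSum φ f) atTop := by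
        simp only [lintegral_rieszDensity hab ν hνpos]
    _ ≤ limsup (fun n => (dyadicPartition hab n).rieszSum φ f) atTop := liminf_le_limsup
    _ = limsup (fun P : Partition a b => P.rieszSum φ f)
          (map (fun n => dyadicPartition hab n) atTop) := rfl
    _ ≤ limsupVariation φ a b f := limsup_le_limsup_of_le
        (map_le_iff_le_comap.2 (by
          rw [comap_comap]; exact (tendsto_mesh_dyadicPartition hab).le_comap))

end Lower

end RieszBV

theorem theorem5p4 (a b : ℝ) (hab : a < b) (φ : ℝ → ℝ≥0 → ℝ≥0∞)
    (hφ : RieszBV.IsConvexPhi (Icc a b) φ) (hVA1 : RieszBV.VA1 (Icc a b) φ)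
    (hDec : RieszBV.Dec (Icc a b) φ)
    (f : ℝ → ℝ) (hf : BoundedVariationOn f (Icc a b))
    (hfl : ∀ x ∈ Ioc a b, ContinuousWithinAt f (Iic x) x) :
    RieszBV.limsupVariation φ a b f =
      (∫⁻ x in Icc a b, φ x ‖RieszBV.derivDensity hab.le hf x‖₊) +
        ∫⁻ x in Icc a b, RieszBV.recession φ x ∂(RieszBV.singularVariation hab.le hf) := by
  obtain ⟨q, -, hd⟩ := hDec
  exact le_antisymm (RieszBV.limsupVariation_le hφ hd hVA1 hfl)
    (RieszBV.relaxedEnergy_le_limsupVariation hab hf hφ hd hfl)
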